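/- **Setting.** Let $\Pi$ (decisions) and $\mathcal O$ (observations) be measurable spaces such that $\Pi$ is countable or the $\sigma$-algebra of $\mathcal O$ is countably generated, and let $\mathcal R\subseteq\mathbb R$ (rewards). A *model* is a measurable map (Markov kernel) $M:\Pi\to\triangle_{\mathcal R\times\mathcal O}$ whose mean reward $f^M(\pi)=\mathbb E_{(r,o)\sim M(\pi)}[r]$ exists and lies in $[0,1]$ for every $\pi$; $\mathcal M^+$ is the set of all models. Let $\mathcal M\subseteq\mathcal M^+$ be a model class. Write $\boldsymbol\pi_M=\arg\max_\pi f^M(\pi)$, $\Delta^M(\pi)=\sup_{\pi'}f^M(\pi')-f^M(\pi)$, $\mathcal M^{\mathrm{alt}}(M)=\{M'\in\mathcal M:\boldsymbol\pi_M\cap\boldsymbol\pi_{M'}=\emptyset\}$, and define the Graves–Lai coefficient $$g^M=\inf_{\eta\in\mathbb R_+^\Pi}\Big\{\sum_\pi\eta(\pi)\Delta^M(\pi)\ :\ \sum_\pi\eta(\pi)D_{\mathrm{KL}}(M(\pi)\|M'(\pi))\ge 1\ \ \forall M'\in\mathcal M^{\mathrm{alt}}(M)\Big\}\in[0,\infty].$$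 For $\varepsilon>0$ and $\bar n\ge 0$ let $\Lambda(M;\varepsilon,\bar n)$ be the set of probability distributions $\lambda\in\triangle_\Pi$ for which there is $n\in(0,\bar n]$ with $$\mathbb E_{\pi\sim\lambda}[\Delta^M(\pi)]\le\frac{(1+\varepsilon)g^M}{n}\quad\text{and}\quad\inf_{M'\in\mathcal M^{\mathrm{alt}}(M)}\mathbb E_{\pi\sim\lambda}[D_{\mathrm{KL}}(M(\pi)\|M'(\pi))]\ge\frac{1-\varepsilon}{n},$$ and let $\Lambda(M;\varepsilon)=\bigcup_{\bar n>0}\Lambda(M;\varepsilon,\bar n)$. For $\mathcal M_0\subseteq\mathcal M$ and $\overline M\in\mathcal M^+$ let $$\mathrm{AEC}_\varepsilon(\mathcal M_0,\overline M)=\inf_{\lambda,\omega\in\triangle_\Pi}\ \sup_{M\in\mathcal M_0:\ \lambda\notin\Lambda(M;\varepsilon)}\ \frac1{\mathbb E_{\pi\sim\omega}[D_{\mathrm{KL}}(\overline M(\pi)\|M(\pi))]}\in[0,\infty],$$ with $\sup\emptyset=0$, $1/0=\infty$, $1/\infty=0$. An *algorithm* with $T$ rounds samples, in round $t=1,\dots,T$,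 a decision $\pi^t\sim p^t(\cdot\mid\mathcal H^{t-1})$, observes $(r^t,o^t)\sim M(\pi^t)$, where $\mathcal H^t=(\pi^1,r^1,o^1),\dots,(\pi^t,r^t,o^t)$, and finally returns $\hat\lambda\sim q(\cdot\mid\mathcal H^T)$ in $\triangle_\Pi$; here $p^1,\dots,p^T$ and $q$ are arbitrary Markov kernels. $\mathbb P^{M,\mathbb A}$ denotes the resulting law when $M$ is the true model and $\mathbb A$ is the algorithm. **Theorem.** Let $\varepsilon>0$, $\mathcal M_0\subseteq\mathcal M$, let $(\bar n_M)_{M\in\mathcal M_0}$ be non-negative reals, and set $$\delta=\frac\varepsilon2\cdot\min\Big\{1,\ \inf_{M\in\mathcal M_0}\frac{g^M}{\bar n_M}\Big\}$$ (with $\inf\emptyset=\infty$, $g/0=\infty$ for $g>0$, and $0/0=0$). Let $T\ge1$ be an integer. Unless $$T>\frac\delta8\cdot\sup_{\overline M\in\mathcal M^+}\mathrm{AEC}_{2\varepsilon}(\mathcal M_0,\overline M)$$ (with $0\cdot\infty=0$), for every algorithm $\mathbb A$ with $T$ rounds there is $M\in\mathcal M_0$ such that $$\mathbb P^{M,\mathbb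 A}\big[\hat\lambda\notin\Lambda(M;\varepsilon,\bar n_M)\big]\ge\frac\delta6 .$$ In particular, this holds with $\bar n_M=n_{\max}$ for all $M$, for any given $n_{\max}>0$. -/

import Mathlib

open MeasureTheory ProbabilityTheory InformationTheory
open scoped ENNReal NNReal

noncomputable section

namespace GravesLai

/-- A model (an element of the set of all models): a measurable map from decisions to
probability distributions over (reward, observation) pairs, whose mean reward exists and lies in
`[0,1]` for each decision. Rewards take values in the set `R` of reals. -/
structure Model (D : Type*) [MeasurableSpace D] (R : Set ℝ) (O : Type*) [MeasurableSpace O] where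
  kernel : Kernel D (R × O)
  isMarkov : IsMarkovKernel kernel
  integrable_reward : ∀ d, Integrable (fun x : R × O => (x.1 : ℝ)) (kernel d)
  mean_mem : ∀ d, ∫ x, (x.1 : ℝ) ∂(kernel d) ∈ Set.Icc (0 : ℝ) 1

section Allocations

variable {D : Type*} [MeasurableSpace D] {R : Set ℝ} {O : Type*} [MeasurableSpace O]

/-- The mean reward function `f^M`. -/
def Model.mean (M : Model D R O) (d : D) : ℝ := ∫ x, (x.1 : ℝ) ∂(M.kernel d)

/-- The set of optimal decisions of `M`. -/
def Model.optimal (M : Model D R O) : Set D := {d | ∀ d', M.mean d' ≤ M.mean d}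

/-- The suboptimality gap: maximal mean reward minus mean reward (mean rewards are bounded, so the
supremum is a genuine one; it is the maximum if `M` has an optimal decision). -/
def Model.gap (M : Model D R O) (d : D) : ℝ := (⨆ d', M.mean d') - M.mean d

/-- The divergence `KL(M(d) ‖ M'(d))`, with values in `[0,∞]`. -/
def Model.kl (M M' : Model D R O) (d : D) : ℝ≥0∞ := klDiv (M.kernel d) (M'.kernel d)

/-- The models of the class `C` having no optimal decision in common with `M`. -/
def alt (C : Set (Model D R O)) (M : Model D R O) : Set (Model D R O) :=
  {M' ∈ C | Disjoint M.optimal M'.optimal}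

/-- The Graves-Lai coefficient of `M` with respect to the class `C` (infinite if no allocation is
feasible). -/
def glc (C : Set (Model D R O)) (M : Model D R O) : ℝ≥0∞ :=
  ⨅ η ∈ {η : D → ℝ≥0 | ∀ M' ∈ alt C M, 1 ≤ ∑' d, (η d : ℝ≥0∞) * M.kl M' d},
    ∑' d, (η d : ℝ≥0∞) * ENNReal.ofReal (M.gap d)

/-- The expected gap of `M` under a normalized allocation. -/
def expectedGap (M : Model D R O) (lam : ProbabilityMeasure D) : ℝ≥0∞ :=
  ∫⁻ d, ENNReal.ofReal (M.gap d) ∂(lam : Measure D)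

/-- The expected divergence `E_{d ∼ lam} KL(M(d) ‖ M'(d))`. -/
def expectedKL (M M' : Model D R O) (lam : ProbabilityMeasure D) : ℝ≥0∞ :=
  ∫⁻ d, M.kl M' d ∂(lam : Measure D)

/-- `lam` satisfies both approximate optimality constraints of the Graves-Lai program for `M`,
with tolerance `ε` and normalization factor `n`. A negative value of `(1 - ε) / n` is truncated to
zero, which does not change the second constraint since its left-hand side is nonnegative. -/
def IsOptimalWith (C : Set (Model D R O)) (M : Model D R O) (ε n : ℝ)
    (lam : ProbabilityMeasure D) : Prop :=
  expectedGap M lam ≤ ENNReal.ofReal ((1 + ε) / n) * glc C M ∧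
  ENNReal.ofReal ((1 - ε) / n) ≤ ⨅ M' ∈ alt C M, expectedKL M M' lam

/-- The `ε`-optimal normalized Graves-Lai allocations for `M`. -/
def Lam (C : Set (Model D R O)) (M : Model D R O) (ε : ℝ) : Set (ProbabilityMeasure D) :=
  {lam | ∃ n : ℝ, 0 < n ∧ IsOptimalWith C M ε n lam}

/-- The `ε`-optimal normalized Graves-Lai allocations for `M` with normalization factor at most
`nmax`. -/
def LamMax (C : Set (Model D R O)) (M : Model D R O) (ε nmax : ℝ) :
    Set (ProbabilityMeasure D) :=
  {lam | ∃ n : ℝ, 0 < n ∧ n ≤ nmax ∧ IsOptimalWith C M ε n lam}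

/-- The models of the class `C` for which `lam` is an `ε`-optimal Graves-Lai allocation. -/
def gravesLaiModels (C : Set (Model D R O)) (ε : ℝ) (lam : ProbabilityMeasure D) :
    Set (Model D R O) :=
  {M ∈ C | lam ∈ Lam C M ε}

/-- The Allocation-Estimation Coefficient of the subset `C₀` of the class `C` at the reference
model `Mbar`; in `[0,∞]`, the supremum over the empty set is `0`, `0⁻¹ = ∞` and `∞⁻¹ = 0`. -/
def aec (C : Set (Model D R O)) (ε : ℝ) (C₀ : Set (Model D R O)) (Mbar : Model D R O) : ℝ≥0∞ :=
  ⨅ (lam : ProbabilityMeasure D) (ω : ProbabilityMeasure D),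
    ⨆ M ∈ C₀ \ gravesLaiModels C ε lam, (expectedKL Mbar M ω)⁻¹

end Allocations

/-- Histories of length `t`: the `t`-fold product of `Z`, as iterated pairs. -/
def History.{u} (Z : Type u) : ℕ → Type u
  | 0 => PUnit
  | t + 1 => History Z t × Z

/-- The product σ-algebra on histories. -/
instance History.instMeasurableSpace (Z : Type*) [MeasurableSpace Z] :
    (t : ℕ) → MeasurableSpace (History Z t)
  | 0 => (inferInstance : MeasurableSpace PUnit)
  | t + 1 =>
    letI := History.instMeasurableSpace Z t
    (inferInstance : MeasurableSpace (History Z t × Z))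

/-- An algorithm with `T` rounds: given the history of the first `t` rounds, it samples the next
decision from `explore t` (only `t < T` is ever used), and given the whole history it samples the
returned normalized allocation from `output`. -/
structure Algorithm (D : Type*) [MeasurableSpace D] (R : Set ℝ) (O : Type*) [MeasurableSpace O]
    (T : ℕ) where
  explore : (t : ℕ) → Kernel (History (D × R × O) t) D
  explore_isMarkov : ∀ t, IsMarkovKernel (explore t)
  output : Kernel (History (D × R × O) T) (ProbabilityMeasure D)
  output_isMarkov : IsMarkovKernel output

section Laws

variable {D : Type*} [MeasurableSpace D] {R : Set ℝ} {O : Type*} [MeasurableSpace O] {T : ℕ}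

/-- The conditional law of (decision, reward, observation) in round `t + 1` given the history. -/
def Algorithm.round (A : Algorithm D R O T) (M : Model D R O) (t : ℕ) :
    Kernel (History (D × R × O) t) (D × R × O) :=
  Kernel.compProd (A.explore t) (Kernel.prodMkLeft (History (D × R × O) t) M.kernel)

/-- The law of the history after `t` rounds when `M` is the underlying model. -/
def Algorithm.historyLaw (A : Algorithm D R O T) (M : Model D R O) :
    (t : ℕ) → Measure (History (D × R × O) t)
  | 0 => Measure.dirac PUnit.unit
  | t + 1 => Measure.compProd (A.historyLaw M t) (A.round M t)

/-- The law of the returned allocation after `T` rounds when `M` is the underlying model. -/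
def Algorithm.outputLaw (A : Algorithm D R O T) (M : Model D R O) :
    Measure (ProbabilityMeasure D) :=
  (A.historyLaw M T).bind A.output

end Laws

end GravesLai

end

/-!
# Lower bound for learning a Graves–Lai allocation

The theorem is proved in contrapositive form. Suppose that under each model `M` of `C₀` the
algorithm returns an allocation outside `LamMax C M ε (nbar M)` with probability below `δ / 6`. For
an arbitrary reference model `Mbar`, run the algorithm on `Mbar`; let `ω` be the average law of the
decisions it plays, and let `lam` be the mixture of the allocation it returns. This pair witnesses
`aec C (2 * ε) C₀ Mbar ≤ 2 * T / δ` (`aec_le_of_outputLaw_lt`), which contradicts `T` being at most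
`δ / 8` times the supremum of the coefficients. There are three ingredients.

* Mixing (`mixture_mem_Lam`). Both constraints of the Graves–Lai program are linear in the pair of
  allocation and reciprocal normalization factor. If the returned allocation is `ε`-optimal for `M`
  outside an event `B`, with normalization factor at most `nbar M`, then averaging the reciprocal
  factors over `Bᶜ` gives a factor for which the mixture is `2ε`-optimal. The part on `B` costs at
  most its probability in the gap constraint, and `δ ≤ (ε / 2) * glc C M / nbar M` makes the change
  of tolerance from `ε` to `2ε` pay for this. Hence, if `lam` is not `2ε`-optimal for `M`, then
  `B` has probability at least a constant multiple of `δ` under `Mbar`.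
* Change of measure (`measure_le_two_mul_klDiv_add`). The event `B` has probability below `δ / 6`
  under `M`, so the divergence between the output laws under `Mbar` and `M` is at least `δ / 2`.
* Chain rule (`klDiv_outputLaw_le`). That divergence is at most `T` times the expected divergence
  from `Mbar` to `M` under `ω`. The countability assumption serves to make `d ↦ KL(M(d) ‖ M'(d))`
  measurable and to write conditional divergences as integrals.

The argument needs `δ ≤ 1 / 4`, which holds for `ε < 1 / 2`. For larger `ε` every allocation is
`2ε`-optimal for every model of `C₀`, and the coefficient vanishes (`mem_Lam_of_one_le`).
-/

/-! ### Kullback–Leibler divergence of kernels -/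

section KullbackLeibler

variable {α β γ : Type*} [MeasurableSpace α] [MeasurableSpace β] [MeasurableSpace γ]

/-- The divergence between two finite kernels is a measurable function of the source point. -/
theorem measurable_klDiv_kernel [MeasurableSpace.CountableOrCountablyGenerated β γ]
    (κ η : Kernel β γ) [IsFiniteKernel κ] [IsFiniteKernel η] :
    Measurable fun b => klDiv (κ b) (η b) := by
  classical
  have h : (fun b => klDiv (κ b) (η b)) = fun b =>
      if κ b ≪ η b then ∫⁻ x, ENNReal.ofReal (klFun (κ.rnDeriv η b x).toReal) ∂(η b) else ∞ := by
    funext b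
    rw [klDiv_eq_lintegral_klFun]
    refine if_congr Iff.rfl (lintegral_congr_ae ?_) rfl
    filter_upwards [Kernel.rnDeriv_eq_rnDeriv_measure (κ := κ) (η := η) (a := b)] with x hx
    rw [hx]
  rw [h]
  refine Measurable.ite (Kernel.measurableSet_absolutelyContinuous κ η) ?_ measurable_const
  have := Kernel.measurable_rnDeriv κ η
  exact Measurable.lintegral_kernel_prod_right (κ := η) (by
    change Measurable fun p : β × γ => ENNReal.ofReal (klFun (κ.rnDeriv η p.1 p.2).toReal)
    fun_prop)

/-- Conditional divergence as an integral. The kernels are pulled back along `g` so that the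
countability assumption is only needed for `β`, whatever the size of `α`. -/
theorem klDiv_compProd_comap_le [MeasurableSpace.CountableOrCountablyGenerated β γ]
    (μ : Measure α) [IsFiniteMeasure μ] (κ η : Kernel β γ) [IsFiniteKernel κ] [IsFiniteKernel η]
    {g : α → β} (hg : Measurable g) :
    klDiv (μ.compProd (κ.comap g hg)) (μ.compProd (η.comap g hg)) ≤
      ∫⁻ a, klDiv (κ (g a)) (η (g a)) ∂μ := by
  by_cases htop : ∫⁻ a, klDiv (κ (g a)) (η (g a)) ∂μ = ∞
  · rw [htop]; exact le_top
  have hmeas : Measurable fun a => klDiv (κ (g a)) (η (g a)) :=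
    (measurable_klDiv_kernel κ η).comp hg
  have hac : ∀ᵐ a ∂μ, κ (g a) ≪ η (g a) := by
    filter_upwards [ae_lt_top hmeas htop] with a ha
    exact (klDiv_ne_top_iff.mp ha.ne).1
  let f : α → γ → ℝ≥0∞ := fun a x => κ.rnDeriv η (g a) x
  have hf : Measurable (Function.uncurry f) :=
    (Kernel.measurable_rnDeriv κ η).comp (hg.prodMap measurable_id)
  have hdens : ∀ a, (η.comap g hg).withDensity f a = η.withDensity (κ.rnDeriv η) (g a) := by
    intro a
    rw [Kernel.withDensity_apply _ hf, Kernel.withDensity_apply _ (Kernel.measurable_rnDeriv κ η),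
      Kernel.comap_apply]
  have : IsFiniteKernel ((η.comap g hg).withDensity f) := by
    refine ⟨⟨κ.bound, κ.bound_lt_top, fun a => ?_⟩⟩
    rw [hdens]
    exact (Kernel.withDensity_rnDeriv_le κ η (g a) _).trans (Kernel.measure_le_bound κ _ _)
  have heq : μ.compProd (κ.comap g hg) =
      (μ.compProd (η.comap g hg)).withDensity (Function.uncurry f) := by
    have h := Measure.compProd_withDensity (μ := μ) (κ := η.comap g hg) hf
    change _ = (μ.compProd (η.comap g hg)).withDensity (fun p => f p.1 p.2)
    rw [← h]
    refine Measure.compProd_congr ?_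
    filter_upwards [hac] with a ha
    rw [hdens, Kernel.comap_apply, Kernel.withDensity_rnDeriv_eq ha]
  rw [klDiv_eq_lintegral_klFun_of_ac (heq ▸ withDensity_absolutelyContinuous _ _)]
  have hrn : (μ.compProd (κ.comap g hg)).rnDeriv (μ.compProd (η.comap g hg)) =ᵐ[
      μ.compProd (η.comap g hg)] Function.uncurry f := by
    rw [heq]; exact Measure.rnDeriv_withDensity _ hf
  refine le_of_eq ?_
  calc ∫⁻ p, ENNReal.ofReal (klFun ((μ.compProd (κ.comap g hg)).rnDeriv
          (μ.compProd (η.comap g hg)) p).toReal) ∂(μ.compProd (η.comap g hg))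
      = ∫⁻ p, ENNReal.ofReal (klFun (Function.uncurry f p).toReal)
          ∂(μ.compProd (η.comap g hg)) := by
        refine lintegral_congr_ae ?_
        filter_upwards [hrn] with p hp
        rw [hp]
    _ = ∫⁻ a, ∫⁻ x, ENNReal.ofReal (klFun (f a x).toReal) ∂(η (g a)) ∂μ := by
        rw [Measure.lintegral_compProd (by fun_prop)]
        rfl
    _ = _ := by
        refine lintegral_congr_ae ?_
        filter_upwards [hac] with a ha
        rw [klDiv_eq_lintegral_klFun_of_ac ha]
        refine lintegral_congr_ae ?_
        filter_upwards [Kernel.rnDeriv_eq_rnDeriv_measure (κ := κ) (η := η) (a := g a)] with x hx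
        rw [← hx]

theorem half_le_klFun_add_one {x : ℝ} (hx : 0 ≤ x) : x / 2 ≤ klFun x + 1 := by
  rcases hx.eq_or_lt with rfl | hx
  · simp [klFun_zero]
  -- tangent line at `2`, which gives `klFun x ≥ x * log 2 - 1`
  have hlog : Real.log 2 + 1 - 2 / x ≤ Real.log x := by
    have h := Real.log_le_sub_one_of_pos (div_pos two_pos hx)
    rw [Real.log_div two_ne_zero hx.ne'] at h
    linarith
  have hmul := mul_le_mul_of_nonneg_left hlog hx.le
  have hcancel : x * (2 / x) = 2 := by field_simp
  have htwo : x * (1 / 2) ≤ x * Real.log 2 :=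
    mul_le_mul_of_nonneg_left (by linarith [Real.log_two_gt_d9]) hx.le
  rw [klFun_apply]
  nlinarith

/-- Change of measure: an event that is likely under `μ` and unlikely under `ν` forces the
divergence from `μ` to `ν` to be large. -/
theorem measure_le_two_mul_klDiv_add (μ ν : Measure α) [IsFiniteMeasure μ] [IsFiniteMeasure ν]
    (B : Set α) : μ B ≤ 2 * (klDiv μ ν + ν B) := by
  by_cases hac : μ ≪ ν
  swap
  · simp [klDiv_of_not_ac hac, ENNReal.mul_top]
  have hpt : ∀ᵐ x ∂ν, μ.rnDeriv ν x ≤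
      2 * (ENNReal.ofReal (klFun (μ.rnDeriv ν x).toReal) + 1) := by
    filter_upwards [μ.rnDeriv_ne_top ν] with x hx
    have h0 : 0 ≤ (μ.rnDeriv ν x).toReal := ENNReal.toReal_nonneg
    have h := half_le_klFun_add_one h0
    have hk : 0 ≤ klFun (μ.rnDeriv ν x).toReal := klFun_nonneg h0
    rw [← ENNReal.ofReal_toReal hx, ← ENNReal.ofReal_one, ← ENNReal.ofReal_ofNat 2,
      ENNReal.toReal_ofReal h0, ← ENNReal.ofReal_add hk zero_le_one,
      ← ENNReal.ofReal_mul zero_le_two]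
    exact ENNReal.ofReal_le_ofReal (by linarith)
  calc μ B = ∫⁻ x in B, μ.rnDeriv ν x ∂ν := (Measure.setLIntegral_rnDeriv hac B).symm
    _ ≤ ∫⁻ x in B, 2 * (ENNReal.ofReal (klFun (μ.rnDeriv ν x).toReal) + 1) ∂ν :=
        lintegral_mono_ae (ae_restrict_of_ae hpt)
    _ = 2 * (∫⁻ x in B, ENNReal.ofReal (klFun (μ.rnDeriv ν x).toReal) ∂ν + ν B) := by
        rw [lintegral_const_mul _ (by fun_prop), lintegral_add_right _ measurable_const]
        simp
    _ ≤ 2 * (klDiv μ ν + ν B) := by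
        rw [klDiv_eq_lintegral_klFun_of_ac hac]
        gcongr
        exact Measure.restrict_le_self

end KullbackLeibler

noncomputable section

namespace GravesLai

/-! ### Measurability and bounds for models -/

section Models

variable {D : Type*} [MeasurableSpace D] {R : Set ℝ} {O : Type*} [MeasurableSpace O]

instance (M : Model D R O) : IsMarkovKernel M.kernel := M.isMarkov

theorem Model.measurable_mean (M : Model D R O) : Measurable M.mean := by
  have h : StronglyMeasurable fun d => ∫ x, (x.1 : ℝ) ∂(M.kernel d) :=
    StronglyMeasurable.integral_kernel_prod_right' (f := fun p : D × R × O => (p.2.1 : ℝ))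
      (by fun_prop : Measurable fun p : D × R × O => (p.2.1 : ℝ)).stronglyMeasurable
  exact h.measurable

theorem Model.measurable_gap (M : Model D R O) : Measurable M.gap :=
  measurable_const.sub M.measurable_mean

theorem Model.gap_le_one (M : Model D R O) (d : D) : M.gap d ≤ 1 := by
  have : Nonempty D := ⟨d⟩
  have h : ⨆ d', M.mean d' ≤ 1 := ciSup_le fun d' => (M.mean_mem d').2
  have h0 : 0 ≤ M.mean d := (M.mean_mem d).1
  unfold Model.gap
  linarith

theorem expectedGap_le_one (M : Model D R O) (lam : ProbabilityMeasure D) :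
    expectedGap M lam ≤ 1 := by
  calc expectedGap M lam ≤ ∫⁻ _, 1 ∂(lam : Measure D) :=
        lintegral_mono fun d => ENNReal.ofReal_le_one.2 (M.gap_le_one d)
    _ = 1 := by simp

theorem Model.measurable_kl [MeasurableSpace.CountableOrCountablyGenerated D O]
    (M M' : Model D R O) : Measurable (M.kl M') := by
  have : MeasurableSpace.CountableOrCountablyGenerated D (R × O) := by
    rcases ‹MeasurableSpace.CountableOrCountablyGenerated D O› with h | h <;> infer_instance
  exact measurable_klDiv_kernel M.kernel M'.kernel

end Models

/-! ### Mixtures of allocations -/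

section Mixture

variable {D : Type*} [MeasurableSpace D]

theorem measurable_coe_probabilityMeasure :
    Measurable fun lam : ProbabilityMeasure D => (lam : Measure D) :=
  measurable_subtype_coe

/-- The barycenter of a random allocation: the law of a decision drawn from an allocation which is
itself drawn from `Q`. -/
def mixture (Q : Measure (ProbabilityMeasure D)) [IsProbabilityMeasure Q] :
    ProbabilityMeasure D :=
  ⟨Q.bind fun lam => (lam : Measure D),
    isProbabilityMeasure_bind measurable_coe_probabilityMeasure.aemeasurable
      (Filter.Eventually.of_forall fun _ => inferInstance)⟩

theorem lintegral_mixture (Q : Measure (ProbabilityMeasure D)) [IsProbabilityMeasure Q]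
    {f : D → ℝ≥0∞} (hf : Measurable f) :
    ∫⁻ d, f d ∂(mixture Q : Measure D) = ∫⁻ lam, ∫⁻ d, f d ∂(lam : Measure D) ∂Q :=
  Measure.lintegral_bind measurable_coe_probabilityMeasure.aemeasurable hf.aemeasurable

variable {R : Set ℝ} {O : Type*} [MeasurableSpace O]

theorem measurable_expectedGap (M : Model D R O) : Measurable (expectedGap M) :=
  (Measure.measurable_lintegral M.measurable_gap.ennreal_ofReal).comp
    measurable_coe_probabilityMeasure

/-- If a random allocation is `ε`-optimal for `M` with normalization factor at most `nmax`, except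
on an event `B` of small probability, then its mixture is `2ε`-optimal. The reciprocal of the
normalization factor of the mixture is the integral over `Bᶜ` of the smallest reciprocal that is
compatible with the gap constraint and with the bound `nmax`. -/
theorem mixture_mem_Lam [MeasurableSpace.CountableOrCountablyGenerated D O]
    (C : Set (Model D R O)) (M : Model D R O) {ε : ℝ} (hε : 0 < ε) {nmax : ℝ≥0} (hn : nmax ≠ 0)
    (hg : glc C M ≠ 0) (Q : Measure (ProbabilityMeasure D)) [IsProbabilityMeasure Q]
    {B : Set (ProbabilityMeasure D)} (hB : MeasurableSet B) (hBc : Bᶜ ⊆ LamMax C M ε nmax)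
    (hQ : Q B ≤ ENNReal.ofReal ε * (glc C M / nmax) * Q Bᶜ) :
    mixture Q ∈ Lam C M (2 * ε) := by
  set g := glc C M with hgdef
  set a := ENNReal.ofReal (1 + ε) with ha
  have ha0 : a ≠ 0 := by simp [ha]; linarith
  have hatop : a ≠ ∞ := ENNReal.ofReal_ne_top
  have hn' : (nmax : ℝ≥0∞) ≠ 0 := by exact_mod_cast hn
  -- choosing the smallest admissible reciprocal makes it a measurable function of the allocation
  let ν : ProbabilityMeasure D → ℝ≥0∞ := fun lam =>
    max (nmax : ℝ≥0∞)⁻¹ (expectedGap M lam / (a * g))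
  have hνmeas : Measurable ν :=
    measurable_const.max ((measurable_expectedGap M).div_const _)
  let s := ∫⁻ lam in Bᶜ, ν lam ∂Q
  have hsge : (nmax : ℝ≥0∞)⁻¹ * Q Bᶜ ≤ s := by
    rw [← setLIntegral_const]
    exact lintegral_mono fun lam => le_max_left _ _
  have hQc : Q Bᶜ ≠ 0 := by
    intro h0
    rw [h0, mul_zero] at hQ
    have h1 := measure_add_measure_compl hB (μ := Q)
    rw [h0, nonpos_iff_eq_zero.1 hQ, measure_univ] at h1
    simp at h1
  have hs0 : s ≠ 0 := by
    intro h0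
    rw [h0, nonpos_iff_eq_zero, mul_eq_zero, ENNReal.inv_eq_zero] at hsge
    exact hsge.elim ENNReal.coe_ne_top hQc
  have hsfin : s ≠ ∞ := by
    have hb : ∀ lam, ν lam ≤ max (nmax : ℝ≥0∞)⁻¹ (1 / (a * g)) := fun lam =>
      max_le_max le_rfl (ENNReal.div_le_div_right (expectedGap_le_one M lam) _)
    refine ne_top_of_le_ne_top ?_ ((setLIntegral_le_lintegral _ _).trans (lintegral_mono hb))
    rw [lintegral_const, measure_univ, mul_one]
    refine (max_lt (ENNReal.inv_lt_top.2 (pos_iff_ne_zero.2 hn')) ?_).ne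
    exact ENNReal.div_lt_top ENNReal.one_ne_top (mul_ne_zero ha0 hg)
  have hνle : ∀ lam ∈ Bᶜ, ∃ n : ℝ, 0 < n ∧ ν lam ≤ ENNReal.ofReal (1 / n) ∧
      IsOptimalWith C M ε n lam := by
    intro lam hlam
    obtain ⟨n, hn0, hnle, hopt⟩ := hBc hlam
    refine ⟨n, hn0, max_le ?_ ?_, hopt⟩
    · rw [one_div, ENNReal.ofReal_inv_of_pos hn0, ENNReal.inv_le_inv]
      exact ENNReal.ofReal_le_of_le_toReal (by simpa using hnle)
    · refine ENNReal.div_le_of_le_mul (hopt.1.trans (le_of_eq ?_))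
      rw [div_eq_mul_one_div, ENNReal.ofReal_mul (by linarith), ← mul_assoc]
      ring
  have hspos : 0 < s.toReal := ENNReal.toReal_pos hs0 hsfin
  have hscale : ∀ c : ℝ, ENNReal.ofReal (c / (1 / s.toReal)) = ENNReal.ofReal c * s := by
    intro c
    rw [div_div_eq_mul_div, div_one, ENNReal.ofReal_mul' hspos.le, ENNReal.ofReal_toReal hsfin]
  refine ⟨1 / s.toReal, one_div_pos.2 hspos, ?_, ?_⟩
  · rw [hscale]
    by_cases hgtop : g = ∞
    · rw [← hgdef, hgtop, ENNReal.mul_top]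
      · exact le_top
      · refine mul_ne_zero ?_ hs0
        simp; linarith
    have hag0 : a * g ≠ 0 := mul_ne_zero ha0 hg
    have hagtop : a * g ≠ ∞ := ENNReal.mul_ne_top hatop hgtop
    have hgap : ∀ lam, expectedGap M lam ≤ a * g * ν lam := by
      intro lam
      rw [mul_comm]
      exact (ENNReal.div_le_iff hag0 hagtop).1 (le_max_right _ _)
    calc expectedGap M (mixture Q) = ∫⁻ lam, expectedGap M lam ∂Q :=
          lintegral_mixture Q M.measurable_gap.ennreal_ofReal
      _ = ∫⁻ lam in B, expectedGap M lam ∂Q + ∫⁻ lam in Bᶜ, expectedGap M lam ∂Q :=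
          (lintegral_add_compl _ hB).symm
      _ ≤ ∫⁻ _ in B, 1 ∂Q + ∫⁻ lam in Bᶜ, a * g * ν lam ∂Q := by
          gcongr with lam lam
          · exact expectedGap_le_one M lam
          · exact hgap lam
      _ = Q B + a * g * s := by rw [setLIntegral_one, lintegral_const_mul _ hνmeas]
      _ ≤ ENNReal.ofReal ε * g * s + a * g * s := by
          gcongr
          calc Q B ≤ ENNReal.ofReal ε * (g / nmax) * Q Bᶜ := hQ
            _ = ENNReal.ofReal ε * g * ((nmax : ℝ≥0∞)⁻¹ * Q Bᶜ) := by
                rw [div_eq_mul_inv]; ring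
            _ ≤ ENNReal.ofReal ε * g * s := by gcongr
      _ = ENNReal.ofReal (1 + 2 * ε) * s * g := by
          rw [show 1 + 2 * ε = ε + (1 + ε) by ring, ENNReal.ofReal_add hε.le (by linarith)]
          ring
  · rw [hscale]
    refine le_iInf₂ fun M' hM' => ?_
    calc ENNReal.ofReal (1 - 2 * ε) * s ≤ ENNReal.ofReal (1 - ε) * s := by
          gcongr; linarith
      _ = ∫⁻ lam in Bᶜ, ENNReal.ofReal (1 - ε) * ν lam ∂Q :=
          (lintegral_const_mul _ hνmeas).symm
      _ ≤ ∫⁻ lam in Bᶜ, expectedKL M M' lam ∂Q := by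
          refine setLIntegral_mono' hB.compl fun lam hlam => ?_
          obtain ⟨n, hn0, hνn, hopt⟩ := hνle lam hlam
          calc ENNReal.ofReal (1 - ε) * ν lam ≤ ENNReal.ofReal (1 - ε) * ENNReal.ofReal (1 / n) := by
                gcongr
            _ = ENNReal.ofReal ((1 - ε) / n) := by
                rw [← ENNReal.ofReal_mul' (one_div_pos.2 hn0).le, ← div_eq_mul_one_div]
            _ ≤ expectedKL M M' lam := hopt.2.trans (iInf₂_le M' hM')
      _ ≤ ∫⁻ lam, expectedKL M M' lam ∂Q := setLIntegral_le_lintegral _ _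
      _ = expectedKL M M' (mixture Q) := (lintegral_mixture Q (M.measurable_kl M')).symm

/-- For tolerance at least `1` the divergence constraint is vacuous, and a small normalization
factor satisfies the gap constraint. -/
theorem mem_Lam_of_one_le (C : Set (Model D R O)) (M : Model D R O) {ε : ℝ} (hε : 1 ≤ ε)
    (hg : glc C M ≠ 0) (lam : ProbabilityMeasure D) : lam ∈ Lam C M ε := by
  obtain ⟨n, hn0, hn⟩ : ∃ n : ℝ, 0 < n ∧ 1 ≤ ENNReal.ofReal (1 / n) * glc C M := by
    by_cases hgtop : glc C M = ∞
    · exact ⟨1, one_pos, by simp [hgtop]⟩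
    · have hpos := ENNReal.toReal_pos hg hgtop
      refine ⟨_, hpos, ?_⟩
      rw [one_div, ENNReal.ofReal_inv_of_pos hpos, ENNReal.ofReal_toReal hgtop,
        ENNReal.inv_mul_cancel hg hgtop]
  refine ⟨n, hn0, ?_, ?_⟩
  · refine (expectedGap_le_one M lam).trans (hn.trans ?_)
    gcongr
    linarith
  · rw [ENNReal.ofReal_of_nonpos (div_nonpos_of_nonpos_of_nonneg (by linarith) hn0.le)]
    exact zero_le

end Mixture

/-! ### Divergence between the laws of an algorithm under two models -/

section Laws

variable {D : Type*} [MeasurableSpace D] {R : Set ℝ} {O : Type*} [MeasurableSpace O] {T : ℕ}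

instance (A : Algorithm D R O T) (t : ℕ) : IsMarkovKernel (A.explore t) := A.explore_isMarkov t

instance (A : Algorithm D R O T) : IsMarkovKernel A.output := A.output_isMarkov

instance (A : Algorithm D R O T) (M : Model D R O) (t : ℕ) : IsMarkovKernel (A.round M t) := by
  unfold Algorithm.round; infer_instance

instance (A : Algorithm D R O T) (M : Model D R O) (t : ℕ) :
    IsProbabilityMeasure (A.historyLaw M t) := by
  induction t with
  | zero => exact Measure.dirac.isProbabilityMeasure
  | succ t ih =>
    change IsProbabilityMeasure (Measure.compProd (A.historyLaw M t) (A.round M t))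
    infer_instance

instance (A : Algorithm D R O T) (M : Model D R O) : IsProbabilityMeasure (A.outputLaw M) := by
  unfold Algorithm.outputLaw; infer_instance

/-- The law of the decision in round `t + 1` when `M` is the underlying model. -/
def decisionLaw (A : Algorithm D R O T) (M : Model D R O) (t : ℕ) : Measure D :=
  (A.historyLaw M t).bind (A.explore t)

instance (A : Algorithm D R O T) (M : Model D R O) (t : ℕ) :
    IsProbabilityMeasure (decisionLaw A M t) := by
  unfold decisionLaw; infer_instance

/-- One round adds at most the expected divergence of the models at the decision played. -/
theorem klDiv_historyLaw_succ_le [MeasurableSpace.CountableOrCountablyGenerated D O]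
    (A : Algorithm D R O T) (M M' : Model D R O) (t : ℕ) :
    klDiv (A.historyLaw M (t + 1)) (A.historyLaw M' (t + 1)) ≤
      klDiv (A.historyLaw M t) (A.historyLaw M' t) + ∫⁻ d, M.kl M' d ∂(decisionLaw A M t) := by
  have : MeasurableSpace.CountableOrCountablyGenerated D (R × O) := by
    rcases ‹MeasurableSpace.CountableOrCountablyGenerated D O› with h | h <;> infer_instance
  set P := A.historyLaw M t
  set P' := A.historyLaw M' t
  change klDiv (P.compProd (A.round M t)) (P'.compProd (A.round M' t)) ≤ _
  unfold Algorithm.round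
  -- regrouping the triple puts the model kernel last, where it depends on the decision only
  rw [← Measure.compProd_assoc', ← Measure.compProd_assoc']
  calc _ ≤ klDiv ((P.compProd (A.explore t)).compProd (Kernel.prodMkLeft _ M.kernel))
          ((P'.compProd (A.explore t)).compProd (Kernel.prodMkLeft _ M'.kernel)) :=
        klDiv_map_le _ _ MeasurableEquiv.prodAssoc.measurable
    _ = klDiv P P' + klDiv ((P.compProd (A.explore t)).compProd (Kernel.prodMkLeft _ M.kernel))
          ((P.compProd (A.explore t)).compProd (Kernel.prodMkLeft _ M'.kernel)) := by
        rw [klDiv_compProd_eq_add, klDiv_compProd_left]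
    _ ≤ klDiv P P' + ∫⁻ p, M.kl M' p.2 ∂(P.compProd (A.explore t)) := by
        gcongr
        exact klDiv_compProd_comap_le _ M.kernel M'.kernel measurable_snd
    _ = klDiv P P' + ∫⁻ d, M.kl M' d ∂(decisionLaw A M t) := by
        congr 1
        have hm := M.measurable_kl M'
        unfold decisionLaw
        rw [Measure.lintegral_compProd (f := fun p => M.kl M' p.2) (hm.comp measurable_snd),
          Measure.lintegral_bind (A.explore t).measurable.aemeasurable hm.aemeasurable]

theorem klDiv_historyLaw_le [MeasurableSpace.CountableOrCountablyGenerated D O]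
    (A : Algorithm D R O T) (M M' : Model D R O) (t : ℕ) :
    klDiv (A.historyLaw M t) (A.historyLaw M' t) ≤
      ∑ i ∈ Finset.range t, ∫⁻ d, M.kl M' d ∂(decisionLaw A M i) := by
  induction t with
  | zero =>
    change klDiv (Measure.dirac PUnit.unit) (Measure.dirac PUnit.unit) ≤ _
    simp
  | succ t ih =>
    rw [Finset.sum_range_succ]
    exact (klDiv_historyLaw_succ_le A M M' t).trans (add_le_add_left ih _)

/-- The average over the `T` rounds of the laws of the decisions when `M` is the underlying
model. -/
def averageDecisionLaw (A : Algorithm D R O T) (hT : 1 ≤ T) (M : Model D R O) :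
    ProbabilityMeasure D :=
  ⟨(T : ℝ≥0∞)⁻¹ • ∑ i ∈ Finset.range T, decisionLaw A M i, ⟨by
    have hT0 : (T : ℝ≥0∞) ≠ 0 := by exact_mod_cast (by omega : T ≠ 0)
    simp [ENNReal.inv_mul_cancel hT0]⟩⟩

/-- The divergence between the output laws is at most the divergence accumulated over the `T`
rounds, since the output is sampled from the history by the same kernel under both models. -/
theorem klDiv_outputLaw_le [MeasurableSpace.CountableOrCountablyGenerated D O]
    (A : Algorithm D R O T) (hT : 1 ≤ T) (M M' : Model D R O) :
    klDiv (A.outputLaw M) (A.outputLaw M') ≤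
      T * expectedKL M M' (averageDecisionLaw A hT M) := by
  have hT0 : (T : ℝ≥0∞) ≠ 0 := by exact_mod_cast (by omega : T ≠ 0)
  calc klDiv (A.outputLaw M) (A.outputLaw M')
      ≤ klDiv (A.historyLaw M T) (A.historyLaw M' T) := klDiv_comp_right_le _ _ A.output
    _ ≤ ∑ i ∈ Finset.range T, ∫⁻ d, M.kl M' d ∂(decisionLaw A M i) :=
        klDiv_historyLaw_le A M M' T
    _ = T * expectedKL M M' (averageDecisionLaw A hT M) := by
        unfold expectedKL averageDecisionLaw
        rw [ProbabilityMeasure.coe_mk, lintegral_smul_measure, lintegral_finsetSum_measure,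
          smul_eq_mul, ← mul_assoc, ENNReal.mul_inv_cancel hT0 (ENNReal.natCast_ne_top T), one_mul]

end Laws

/-! ### The lower bound -/

section LowerBound

variable {D : Type*} [MeasurableSpace D] {R : Set ℝ} {O : Type*} [MeasurableSpace O] {T : ℕ}

/-- If an algorithm returns a wrong allocation with probability less than `δ / 6` under each model
of `C₀`, then, at every reference model, the mixture of the returned allocations and the average
of the played decisions witness an upper bound on the Allocation-Estimation Coefficient. -/
theorem aec_le_of_outputLaw_lt [MeasurableSpace.CountableOrCountablyGenerated D O]
    (C C₀ : Set (Model D R O)) (hC₀ : C₀ ⊆ C) {ε : ℝ} (hε : 0 < ε) {nbar : Model D R O → ℝ≥0}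
    {δ : ℝ≥0∞} (hδ0 : δ ≠ 0) (hδ4 : δ ≤ 1 / 4)
    (hδ : ∀ M ∈ C₀, 2 * δ ≤ ENNReal.ofReal ε * (glc C M / nbar M)) (hT : 1 ≤ T)
    (A : Algorithm D R O T)
    (hA : ∀ M ∈ C₀, A.outputLaw M {lam | lam ∉ LamMax C M ε (nbar M)} < δ / 6)
    (Mbar : Model D R O) : aec C (2 * ε) C₀ Mbar ≤ 2 * T / δ := by
  have hδtop : δ ≠ ∞ := ne_top_of_le_ne_top (by simp) hδ4
  refine iInf₂_le_of_le (mixture (A.outputLaw Mbar)) (averageDecisionLaw A hT Mbar) ?_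
  refine iSup₂_le fun M hM => ?_
  have hM0 : M ∈ C₀ := hM.1
  have hg : glc C M ≠ 0 := by
    intro h0
    have h := hδ M hM0
    rw [h0, ENNReal.zero_div, mul_zero, nonpos_iff_eq_zero, mul_eq_zero] at h
    exact h.elim two_ne_zero hδ0
  have hn : nbar M ≠ 0 := by
    intro h0
    have hall : {lam | lam ∉ LamMax C M ε (nbar M)} = Set.univ := by
      refine Set.eq_univ_of_forall fun lam => ?_
      rintro ⟨n, hn0, hnle, -⟩
      rw [h0, NNReal.coe_zero] at hnle
      linarith
    have h := hA M hM0
    rw [hall, measure_univ] at h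
    have h6 : δ / 6 ≤ 1 := (ENNReal.div_le_of_le_mul
      (hδ4.trans (by rw [one_mul]; exact (ENNReal.div_le_of_le_mul (by norm_num)))))
    exact absurd h (not_lt.2 h6)
  -- the set of wrong allocations need not be measurable
  set B := toMeasurable (A.outputLaw M) {lam | lam ∉ LamMax C M ε (nbar M)} with hBdef
  have hB : MeasurableSet B := measurableSet_toMeasurable _ _
  have hBc : Bᶜ ⊆ LamMax C M ε (nbar M) := by
    intro lam hlam
    by_contra hnot
    exact hlam (subset_toMeasurable _ _ hnot)
  have hy : A.outputLaw M B < δ / 6 := by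
    rw [hBdef, measure_toMeasurable]; exact hA M hM0
  have hx : 2 * δ * A.outputLaw Mbar Bᶜ < A.outputLaw Mbar B := by
    by_contra! hle
    refine hM.2 ⟨hC₀ hM0, mixture_mem_Lam C M hε hn hg _ hB hBc (hle.trans ?_)⟩
    exact mul_le_mul_left (hδ M hM0) _
  set K := T * expectedKL Mbar M (averageDecisionLaw A hT Mbar) with hK
  have hchange : A.outputLaw Mbar B ≤ 2 * (K + A.outputLaw M B) :=
    (measure_le_two_mul_klDiv_add _ _ B).trans (by
      gcongr; exact klDiv_outputLaw_le A hT Mbar M)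
  have hKδ : δ / 2 ≤ K := by
    -- let `x`, `xc` be the probabilities of `B`, `Bᶜ` under `Mbar`, and `y` that of `B` under `M`;
    -- `x` and `xc` sum to one and `δ ≤ 1 / 4`, so `hx` gives `x > 4 / 3 * δ`, whereas `y < δ / 6`
    by_cases hKtop : K = ∞
    · rw [hKtop]; exact le_top
    have hQ1 := prob_add_prob_compl (μ := A.outputLaw Mbar) hB
    have hxt := measure_ne_top (A.outputLaw Mbar) B
    have hxct := measure_ne_top (A.outputLaw Mbar) Bᶜ
    have hyt := measure_ne_top (A.outputLaw M) B
    generalize A.outputLaw Mbar B = x at *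
    generalize A.outputLaw Mbar Bᶜ = xc at *
    generalize A.outputLaw M B = y at *
    generalize K = k at *
    clear hBc hBdef
    lift x to ℝ≥0 using hxt
    lift xc to ℝ≥0 using hxct
    lift y to ℝ≥0 using hyt
    lift k to ℝ≥0 using hKtop
    lift δ to ℝ≥0 using hδtop
    rw [← ENNReal.toReal_le_toReal (by finiteness) (by finiteness)] at hδ4 hchange ⊢
    rw [← ENNReal.toReal_lt_toReal (by finiteness) (by finiteness)] at hy hx
    have hQ2 : (x : ℝ) + xc = 1 := by exact_mod_cast hQ1
    rw [ENNReal.toReal_mul, ENNReal.toReal_add (by finiteness) (by finiteness)] at hchange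
    simp at hδ4 hchange hx hy ⊢
    have hδnn := δ.coe_nonneg
    have hynn := y.coe_nonneg
    nlinarith
  have hT0 : (T : ℝ≥0∞) ≠ 0 := by exact_mod_cast (by omega : T ≠ 0)
  have hTtop : (T : ℝ≥0∞) ≠ ∞ := ENNReal.natCast_ne_top T
  rw [ENNReal.inv_le_iff_inv_le, ENNReal.inv_div (Or.inl hδtop) (Or.inl hδ0)]
  refine ENNReal.div_le_of_le_mul ?_
  rw [ENNReal.div_le_iff two_ne_zero ENNReal.ofNat_ne_top] at hKδ
  rw [hK] at hKδ
  calc δ ≤ _ := hKδ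
    _ = _ := by ring

end LowerBound

end GravesLai

end

theorem theorem3p1 {D : Type*} [MeasurableSpace D] {R : Set ℝ} {O : Type*} [MeasurableSpace O]
    [MeasurableSpace.CountableOrCountablyGenerated D O]
    (C C₀ : Set (GravesLai.Model D R O)) (hC₀ : C₀ ⊆ C)
    (ε : ℝ) (hε : 0 < ε)
    (nbar : GravesLai.Model D R O → ℝ≥0)
    (δ : ℝ≥0∞)
    (hδ : δ = ENNReal.ofReal (ε / 2) *
      min 1 (⨅ M ∈ C₀, GravesLai.glc C M / (nbar M : ℝ≥0∞)))
    (T : ℕ) (hT : 1 ≤ T)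
    (hTle : ¬ (δ / 8 * (⨆ Mbar : GravesLai.Model D R O, GravesLai.aec C (2 * ε) C₀ Mbar)
      < (T : ℝ≥0∞)))
    (A : GravesLai.Algorithm D R O T) :
    ∃ M ∈ C₀, δ / 6 ≤ A.outputLaw M {lam | lam ∉ GravesLai.LamMax C M ε (nbar M)} := by
  by_contra! hA
  refine hTle ?_
  have hT0 : (T : ℝ≥0∞) ≠ 0 := by exact_mod_cast (by omega : T ≠ 0)
  have hTtop : (T : ℝ≥0∞) ≠ ∞ := ENNReal.natCast_ne_top T
  have hTpos : (0 : ℝ≥0∞) < T := pos_iff_ne_zero.2 hT0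
  by_cases hδ0 : δ = 0
  · simpa [hδ0] using hTpos
  have hδtwo : ∀ M ∈ C₀, 2 * δ ≤ ENNReal.ofReal ε * (GravesLai.glc C M / nbar M) := by
    intro M hM
    calc 2 * δ = 2 * ENNReal.ofReal (ε / 2) *
          min 1 (⨅ M ∈ C₀, GravesLai.glc C M / (nbar M : ℝ≥0∞)) := by rw [hδ, mul_assoc]
      _ ≤ 2 * ENNReal.ofReal (ε / 2) * (GravesLai.glc C M / nbar M) := by
          gcongr
          exact (min_le_right _ _).trans (iInf₂_le M hM)
      _ = ENNReal.ofReal ε * (GravesLai.glc C M / nbar M) := by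
          rw [← ENNReal.ofReal_ofNat 2, ← ENNReal.ofReal_mul zero_le_two,
            mul_div_cancel₀ ε two_ne_zero]
  rcases le_or_gt (1 / 2) ε with hlarge | hsmall
  · -- all allocations are `2ε`-optimal, so the coefficient vanishes
    have haec : ∀ Mbar, GravesLai.aec C (2 * ε) C₀ Mbar = 0 := by
      intro Mbar
      let lam := GravesLai.averageDecisionLaw A hT Mbar
      refine le_antisymm (iInf₂_le_of_le lam lam (iSup₂_le fun M hM => ?_)) zero_le
      have hg : GravesLai.glc C M ≠ 0 := by
        intro h0
        have h := hδtwo M hM.1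
        rw [h0, ENNReal.zero_div, mul_zero, nonpos_iff_eq_zero, mul_eq_zero] at h
        exact h.elim two_ne_zero hδ0
      exact absurd ⟨hC₀ hM.1, GravesLai.mem_Lam_of_one_le C M (by linarith) hg lam⟩ hM.2
    simpa [haec] using hTpos
  have hδ4 : δ ≤ 1 / 4 := by
    calc δ ≤ ENNReal.ofReal (ε / 2) * 1 := by rw [hδ]; gcongr; exact min_le_left _ _
      _ ≤ ENNReal.ofReal (1 / 4) := by rw [mul_one]; exact ENNReal.ofReal_le_ofReal (by linarith)
      _ = 1 / 4 := by rw [ENNReal.ofReal_div_of_pos (by norm_num)]; simp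
  have hδtop : δ ≠ ∞ := ne_top_of_le_ne_top (by simp) hδ4
  calc δ / 8 * (⨆ Mbar, GravesLai.aec C (2 * ε) C₀ Mbar) ≤ δ / 8 * (2 * T / δ) := by
        gcongr
        exact iSup_le (GravesLai.aec_le_of_outputLaw_lt C C₀ hC₀ hε hδ0 hδ4 hδtwo hT A hA)
    _ < T := by
        lift δ to ℝ≥0 using hδtop
        have hd : (δ : ℝ) ≠ 0 := by exact_mod_cast hδ0
        have hTR : (0 : ℝ) < T := by exact_mod_cast hT
        rw [← ENNReal.toReal_lt_toReal (by finiteness) hTtop]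
        simp
        field_simp
        linarith
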